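/- For a field $K \subseteq \mathbb{C}$ and a binary form $f \in K[x,y]$ of degree $d$, let $L_K(f)$ denote the smallest $r$ for which there is a representation $f(x,y) = \sum_{j=1}^r \lambda_j(\alpha_j x + \beta_j y)^d$ with $\lambda_j, \alpha_j, \beta_j \in K$. Let $s(K)$ denote the smallest $n$ such that $-1$ is a sum of $n$ squares in $K$, with $s(K) = \infty$ if $-1$ is not a sum of squares in $K$. Let $f(x,y) = \binom{6}{1}x^5y - \binom{6}{3}x^3y^3 = 6x^5y - 20x^3y^3$. Then for every field $K \subseteq \mathbb{C}$, $L_K(f) = 4$ if and only if $s(K) \le 2$. In particular, if $m$ is a positive square-free integer with $m \not\equiv 7 \pmod 8$, then $L_{\mathbb{Q}(\sqrt{-m})}(f) = 4$. Further, $L_{\mathbb{Q}(\sqrt{-7})}(f) = 5$. -/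

import Mathlib

open MvPolynomial

/-- `f` is a sum of `r` terms `c (a x + b y) ^ d` with all `c, a, b` in the subfield `K` of `ℂ`.
Here `x = X 0` and `y = X 1`. -/
def HasPowerSumRep (K : Subfield ℂ) (d : ℕ) (f : MvPolynomial (Fin 2) ℂ) (r : ℕ) : Prop :=
  ∃ c a b : Fin r → K,
    f = ∑ j, C (c j : ℂ) * (C (a j : ℂ) * X 0 + C (b j : ℂ) * X 1) ^ d

/-- The `K`-length (`K`-rank) of a binary form `f` of degree `d`: the smallest number of terms in
a representation of `f` as a `K`-linear combination of `d`-th powers of linear forms over `K`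
(`⊤` if there is no representation). -/
noncomputable def kLength (K : Subfield ℂ) (d : ℕ) (f : MvPolynomial (Fin 2) ℂ) : ℕ∞ :=
  ⨅ (r : ℕ) (_ : HasPowerSumRep K d f r), (r : ℕ∞)

/-- The Stufe of a field: the smallest `n` such that `-1` is a sum of `n` squares
(`⊤` if `-1` is not a sum of squares, i.e. if the field is formally real). -/
noncomputable def stufe (F : Type*) [Field F] : ℕ∞ :=
  ⨅ (n : ℕ) (_ : ∃ a : Fin n → F, ∑ i, a i ^ 2 = -1), (n : ℕ∞)

/-- The subfield `ℚ(√-m)` of `ℂ`. -/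
noncomputable def imagQuadraticField (m : ℕ) : Subfield ℂ :=
  (IntermediateField.adjoin ℚ {((Real.sqrt m : ℝ) : ℂ) * Complex.I}).toSubfield

/-!
Splitting off the binomial coefficients, `∑ cⱼ (aⱼ x + bⱼ y) ^ d` has the moments of the weights
`cⱼ` at the points `(aⱼ : bⱼ)` as coefficients, so the coefficients of a sum of `r` powers satisfy
the linear recurrence given by the polynomial `P` of degree at most `r` with these points as roots
(Sylvester). For the sextic and `r = 3` this forces `P = 0`, and for `r = 4` it forces
`P = l (X ^ 4 + X ^ 2) + e`. If such a `P` splits and `s` is a root, then so is a root `t` of the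
factor `X ^ 2 + s ^ 2 + 1`, whence `s ^ 2 + t ^ 2 = -1`. Conversely, `s ^ 2 + t ^ 2 = -1` yields a
representation with the nodes `± s, ± t` once these are distinct and nonzero.

In `ℚ(√-m)` the number `-1` is a sum of two squares iff `m` is a sum of three rational squares. For
`m ≡ 7` mod `8` this fails by descent modulo `8`. For the other `m` not divisible by `4`, quadratic
reciprocity and Dirichlet's theorem provide a sum of two squares `Q`, a prime or twice a prime, such
that `Q ≡ -1` mod `m` and `m` is a square mod `Q`; then Legendre's equation
`x ^ 2 + Q y ^ 2 = m z ^ 2` is solvable, by the box principle.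
-/

open scoped Polynomial

theorem iInf_natCast_le_iff {P : ℕ → Prop} (hP : Monotone P) (n : ℕ) :
    (⨅ (k : ℕ) (_ : P k), (k : ℕ∞)) ≤ n ↔ P n := by
  refine ⟨fun h => ?_, fun h => iInf₂_le n h⟩
  have hlt : (⨅ (k : ℕ) (_ : P k), (k : ℕ∞)) < (n + 1 : ℕ) :=
    h.trans_lt (Nat.cast_lt.2 n.lt_succ_self)
  simp only [iInf_lt_iff] at hlt
  obtain ⟨k, hk, hkn⟩ := hlt
  exact hP (Nat.lt_succ_iff.1 (Nat.cast_lt.1 hkn)) hk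

theorem stufe_le_iff {F : Type*} [Field F] (n : ℕ) :
    stufe F ≤ n ↔ ∃ a : Fin n → F, ∑ i, a i ^ 2 = -1 :=
  iInf_natCast_le_iff (P := fun n => ∃ a : Fin n → F, ∑ i, a i ^ 2 = -1)
    (monotone_nat_of_le_succ fun _ ⟨a, ha⟩ => ⟨Fin.cons 0 a, by simp [Fin.sum_univ_succ, ha]⟩) n

theorem stufe_le_two_iff {F : Type*} [Field F] :
    stufe F ≤ 2 ↔ ∃ s t : F, s ^ 2 + t ^ 2 = -1 := by
  refine (stufe_le_iff 2).trans ⟨fun ⟨a, ha⟩ => ⟨a 0, a 1, ?_⟩, fun ⟨s, t, hst⟩ => ⟨![s, t], ?_⟩⟩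
  · rwa [Fin.sum_univ_two] at ha
  · rwa [Fin.sum_univ_two]

theorem hasPowerSumRep_mono {K : Subfield ℂ} {d : ℕ} {f : MvPolynomial (Fin 2) ℂ} :
    Monotone (HasPowerSumRep K d f) :=
  monotone_nat_of_le_succ fun _ ⟨c, a, b, h⟩ =>
    ⟨Fin.cons 0 c, Fin.cons 0 a, Fin.cons 0 b, by simp [Fin.sum_univ_succ, h]⟩

theorem kLength_eq_succ_iff {K : Subfield ℂ} {d : ℕ} {f : MvPolynomial (Fin 2) ℂ} (r : ℕ) :
    kLength K d f = (r + 1 : ℕ) ↔ HasPowerSumRep K d f (r + 1) ∧ ¬ HasPowerSumRep K d f r := by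
  have kLength_le_iff (n : ℕ) : kLength K d f ≤ n ↔ HasPowerSumRep K d f n :=
    iInf_natCast_le_iff hasPowerSumRep_mono n
  rw [← kLength_le_iff, ← kLength_le_iff, not_le, le_antisymm_iff, Nat.cast_add_one,
    ENat.add_one_le_iff (ENat.natCast_ne_top r)]

section Moments

variable {R ι : Type*} [CommRing R] [Fintype ι]

/-- The binary form of degree `d` with normalised coefficients `μ`, where the binomial
coefficients are split off: this turns the coefficients of sums of powers into moments. -/
noncomputable def binaryForm (d : ℕ) (μ : ℕ → R) : MvPolynomial (Fin 2) R :=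
  ∑ k ∈ Finset.range (d + 1), C (d.choose k * μ k) * (X 0 ^ k * X 1 ^ (d - k))

/-- The moment of order `k` of the weights `c` at the points `(a j : b j)` of the projective
line, in homogeneous degree `d`. -/
def powerMoment (d : ℕ) (c a b : ι → R) (k : ℕ) : R :=
  ∑ j, c j * a j ^ k * b j ^ (d - k)

theorem sum_linear_pow_eq_binaryForm (d : ℕ) (c a b : ι → R) :
    ∑ j, C (c j) * (C (a j) * X 0 + C (b j) * X 1) ^ d = binaryForm d (powerMoment d c a b) := by
  simp only [binaryForm, powerMoment, add_pow, Finset.mul_sum, map_sum, Finset.sum_mul]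
  rw [Finset.sum_comm]
  refine Finset.sum_congr rfl fun k _ => Finset.sum_congr rfl fun j _ => ?_
  simp only [map_mul, map_pow, map_natCast]
  ring

theorem coeff_aeval_binaryForm (d : ℕ) (μ : ℕ → R) {k : ℕ} (hk : k ≤ d) :
    (aeval ![Polynomial.X, (1 : R[X])] (binaryForm d μ)).coeff k = d.choose k * μ k := by
  simp only [binaryForm, map_sum, map_mul, aeval_C, map_pow, aeval_X, Matrix.cons_val_zero,
    Matrix.cons_val_one, one_pow, Polynomial.algebraMap_eq, Polynomial.finsetSum_coeff,
    mul_assoc, Polynomial.coeff_C_mul, Polynomial.coeff_X_pow, mul_ite, mul_one, mul_zero]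
  rw [Finset.sum_ite_eq, if_pos (Finset.mem_range_succ_iff.2 hk)]

theorem binaryForm_eq_iff [IsDomain R] [CharZero R] {d : ℕ} {μ ν : ℕ → R} :
    binaryForm d μ = binaryForm d ν ↔ ∀ k ≤ d, μ k = ν k := by
  refine ⟨fun h k hk => ?_, fun h => Finset.sum_congr rfl fun k hk => ?_⟩
  · have hchoose : (d.choose k : R) ≠ 0 := Nat.cast_ne_zero.2 (Nat.choose_pos hk).ne'
    apply mul_left_cancel₀ hchoose
    rw [← coeff_aeval_binaryForm d μ hk, h, coeff_aeval_binaryForm d ν hk]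
  · rw [h k (Finset.mem_range_succ_iff.1 hk)]

theorem hasPowerSumRep_binaryForm_iff {K : Subfield ℂ} {d r : ℕ} {μ : ℕ → K} :
    HasPowerSumRep K d (binaryForm d fun k => (μ k : ℂ)) r ↔
      ∃ c a b : Fin r → K, ∀ k ≤ d, powerMoment d c a b k = μ k := by
  refine exists_congr fun c => exists_congr fun a => exists_congr fun b => ?_
  rw [sum_linear_pow_eq_binaryForm, binaryForm_eq_iff]
  refine forall₂_congr fun k _ => ?_
  rw [eq_comm, ← Subtype.val_inj]
  simp [powerMoment]

/-- The inhomogeneous form of Sylvester's apolar form: its roots are the points `(a j : b j)` of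
the projective line, where a point at infinity only contributes a constant. -/
noncomputable def nodePolynomial (a b : ι → R) : R[X] :=
  ∏ j, (Polynomial.C (b j) * Polynomial.X - Polynomial.C (a j))

theorem natDegree_nodeFactor_le (a b : R) :
    (Polynomial.C b * Polynomial.X - Polynomial.C a).natDegree ≤ 1 := by
  compute_degree

theorem natDegree_nodePolynomial_le (a b : ι → R) :
    (nodePolynomial a b).natDegree ≤ Fintype.card ι := by
  refine (Polynomial.natDegree_prod_le _ _).trans ?_
  simpa using
    Finset.sum_le_card_nsmul Finset.univ _ 1 fun j _ => natDegree_nodeFactor_le (a j) (b j)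

theorem eval_homogenize_eq_sum (p : R[X]) (n : ℕ) (a b : R) :
    eval ![a, b] (p.homogenize n) =
      ∑ i ∈ Finset.range (n + 1), p.coeff i * (a ^ i * b ^ (n - i)) := by
  simp [Polynomial.homogenize, Finset.Nat.sum_antidiagonal_eq_sum_range_succ_mk, eval_monomial,
    Finsupp.prod_fintype]

theorem homogenize_nodePolynomial (a b : ι → R) :
    (nodePolynomial a b).homogenize (Fintype.card ι) = ∏ j, (C (b j) * X 0 - C (a j) * X 1) := by
  have h := Polynomial.homogenize_finsetProd (s := Finset.univ) (n := fun _ : ι => 1)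
    fun j _ => natDegree_nodeFactor_le (a j) (b j)
  rw [Finset.sum_const, Finset.card_univ, smul_eq_mul, mul_one] at h
  simpa [nodePolynomial] using h

theorem sum_coeff_nodePolynomial_mul_powerMoment (c a b : ι → R) {d k : ℕ}
    (h : k + Fintype.card ι ≤ d) :
    ∑ i ∈ Finset.range (Fintype.card ι + 1),
      (nodePolynomial a b).coeff i * powerMoment d c a b (i + k) = 0 := by
  set n := Fintype.card ι
  have root (j : ι) :
      ∑ i ∈ Finset.range (n + 1), (nodePolynomial a b).coeff i * (a j ^ i * b j ^ (n - i)) = 0 := by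
    rw [← eval_homogenize_eq_sum, homogenize_nodePolynomial, map_prod]
    exact Finset.prod_eq_zero (Finset.mem_univ j) (by simp [mul_comm])
  simp only [powerMoment, Finset.mul_sum]
  rw [Finset.sum_comm]
  refine Finset.sum_eq_zero fun j _ => ?_
  rw [← mul_zero (c j * a j ^ k * b j ^ (d - k - n)), ← root j, Finset.mul_sum]
  refine Finset.sum_congr rfl fun i hi => ?_
  have hin := Finset.mem_range_succ_iff.1 hi
  rw [show d - (i + k) = (n - i) + (d - k - n) by omega]
  ring

-- A pair `(0, 0)` is not a point of the projective line; it contributes nothing and may be moved.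
theorem exists_nonzero_nodes [Nontrivial R] {d : ℕ} (hd : d ≠ 0) (c a b : ι → R) :
    ∃ c' a' : ι → R, (∀ j, a' j = 0 → b j ≠ 0) ∧
      ∀ k, powerMoment d c' a' b k = powerMoment d c a b k := by
  classical
  refine ⟨fun j => if a j = 0 ∧ b j = 0 then 0 else c j,
    fun j => if a j = 0 ∧ b j = 0 then 1 else a j, fun j ha hb => ?_, fun k =>
      Finset.sum_congr rfl fun j _ => ?_⟩
  · by_cases haj : a j = 0 <;> simp_all
  · by_cases hj : a j = 0 ∧ b j = 0
    · rcases Nat.eq_zero_or_pos k with rfl | hk0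
      · simp [hj, hd]
      · simp [hj, hk0.ne']
    · simp only [hj, if_false]

end Moments

section Sylvester

variable {F ι : Type*} [Field F] [Fintype ι]

theorem nodePolynomial_ne_zero {a b : ι → F} (hab : ∀ j, a j = 0 → b j ≠ 0) :
    nodePolynomial a b ≠ 0 := by
  refine Finset.prod_ne_zero_iff.2 fun j _ h => hab j ?_ ?_
  · simpa using congrArg (Polynomial.coeff · 0) h
  · simpa using congrArg (Polynomial.coeff · 1) h

theorem splits_nodePolynomial (a b : ι → F) : (nodePolynomial a b).Splits :=
  Polynomial.Splits.prod fun j _ => .of_natDegree_le_one (natDegree_nodeFactor_le (a j) (b j))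

theorem node_denom_eq_zero_of_natDegree_eq_zero {a b : ι → F}
    (hab : ∀ j, a j = 0 → b j ≠ 0) (h : (nodePolynomial a b).natDegree = 0) (j : ι) : b j = 0 := by
  by_contra hb
  have hdvd : Polynomial.C (b j) * Polynomial.X - Polynomial.C (a j) ∣ nodePolynomial a b :=
    Finset.dvd_prod_of_mem _ (Finset.mem_univ j)
  have hdeg := Polynomial.natDegree_le_of_dvd hdvd (nodePolynomial_ne_zero hab)
  rw [h, Polynomial.natDegree_sub_C, Polynomial.natDegree_C_mul_X _ hb] at hdeg
  omega

theorem exists_apolar_polynomial {d : ℕ} (hd : d ≠ 0) {μ : ℕ → F} {c a b : ι → F}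
    (hμ : ∀ k ≤ d, powerMoment d c a b k = μ k) :
    ∃ P : F[X], P ≠ 0 ∧ P.Splits ∧ P.natDegree ≤ Fintype.card ι ∧
      (P.natDegree = 0 → ∀ k < d, μ k = 0) ∧
      ∀ k, k + Fintype.card ι ≤ d →
        ∑ i ∈ Finset.range (Fintype.card ι + 1), P.coeff i * μ (i + k) = 0 := by
  obtain ⟨c', a', hab, hc'⟩ := exists_nonzero_nodes hd c a b
  refine ⟨nodePolynomial a' b, nodePolynomial_ne_zero hab, splits_nodePolynomial a' b,
    natDegree_nodePolynomial_le a' b, fun h k hk => ?_, fun k hk => ?_⟩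
  · have hb := node_denom_eq_zero_of_natDegree_eq_zero hab h
    rw [← hμ k hk.le]
    exact Finset.sum_eq_zero fun j _ => by rw [hb, zero_pow (Nat.sub_ne_zero_of_lt hk), mul_zero]
  · rw [← sum_coeff_nodePolynomial_mul_powerMoment c' a' b hk]
    refine Finset.sum_congr rfl fun i hi => ?_
    rw [hc', hμ (i + k) (by have := Finset.mem_range_succ_iff.1 hi; omega)]

end Sylvester

section Sextic

/-- The normalised coefficients of `6 x⁵ y - 20 x³ y³`. -/
def sexticMoment (R : Type*) [Ring R] (k : ℕ) : R :=
  if k = 5 then 1 else if k = 3 then -1 else 0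

theorem binaryForm_sexticMoment (K : Subfield ℂ) :
    binaryForm 6 (fun k => (sexticMoment K k : ℂ)) =
      6 * X 0 ^ 5 * X 1 - 20 * X 0 ^ 3 * X 1 ^ 3 := by
  simp [binaryForm, Finset.sum_range_succ, sexticMoment, Nat.choose]
  ring

variable {F : Type*} [Field F]

theorem powerMoment_ne_sexticMoment_three (c a b : Fin 3 → F) :
    ¬ ∀ k ≤ 6, powerMoment 6 c a b k = sexticMoment F k := by
  intro hμ
  obtain ⟨P, hP, -, hdeg, -, recurrence⟩ := exists_apolar_polynomial (by decide) hμ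
  rw [Fintype.card_fin] at hdeg recurrence
  have h3 : P.coeff 3 = 0 := by
    simpa [Finset.sum_range_succ, sexticMoment] using recurrence 0
  have h2 : P.coeff 2 = 0 := by
    simpa [Finset.sum_range_succ, sexticMoment] using recurrence 1
  have h1 : P.coeff 1 = 0 := by
    simpa [Finset.sum_range_succ, sexticMoment, h3] using recurrence 2
  have h0 : P.coeff 0 = 0 := by
    simpa [Finset.sum_range_succ, sexticMoment, h2] using recurrence 3
  apply hP
  rw [P.as_sum_range_C_mul_X_pow' (Nat.lt_succ_of_le hdeg)]
  simp [Finset.sum_range_succ, h0, h1, h2, h3]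

theorem exists_sq_add_sq_of_splits {l e : F} (hl : l ≠ 0)
    (h : (Polynomial.C l * (Polynomial.X ^ 4 + Polynomial.X ^ 2) + Polynomial.C e).Splits) :
    ∃ s t : F, s ^ 2 + t ^ 2 = -1 := by
  set P := Polynomial.C l * (Polynomial.X ^ 4 + Polynomial.X ^ 2) + Polynomial.C e with hP
  have hdeg : P.degree = 4 := by rw [hP]; compute_degree!
  obtain ⟨s, hs⟩ := h.exists_eval_eq_zero (by simp [hdeg])
  have he : e = -(l * (s ^ 4 + s ^ 2)) := by
    rw [eq_neg_iff_add_eq_zero, add_comm]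
    simpa [hP] using hs
  have hdvd : Polynomial.X ^ 2 + Polynomial.C (s ^ 2 + 1) ∣ P := by
    refine ⟨Polynomial.C l * (Polynomial.X ^ 2 - Polynomial.C (s ^ 2)), ?_⟩
    rw [hP, he]
    simp only [map_neg, map_mul, map_add, map_pow, map_one]
    ring
  have hP0 : P ≠ 0 := Polynomial.ne_zero_of_degree_gt (n := 0) (by simp [hdeg])
  obtain ⟨t, ht⟩ := (h.of_dvd hP0 hdvd).exists_eval_eq_zero
    (by rw [Polynomial.degree_X_pow_add_C two_pos]; decide)
  rw [Polynomial.eval_add, Polynomial.eval_pow, Polynomial.eval_X, Polynomial.eval_C] at ht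
  exact ⟨s, t, by linear_combination ht⟩

theorem exists_sq_add_sq_of_sexticMoment_four {c a b : Fin 4 → F}
    (hμ : ∀ k ≤ 6, powerMoment 6 c a b k = sexticMoment F k) :
    ∃ s t : F, s ^ 2 + t ^ 2 = -1 := by
  obtain ⟨P, -, hsplits, hdeg, hconst, recurrence⟩ := exists_apolar_polynomial (by decide) hμ
  rw [Fintype.card_fin] at hdeg recurrence
  have hPeq : P = Polynomial.C (P.coeff 4) * (Polynomial.X ^ 4 + Polynomial.X ^ 2) +
      Polynomial.C (P.coeff 0) := by
    have h3 : P.coeff 3 = 0 := by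
      simpa [Finset.sum_range_succ, sexticMoment] using recurrence 0
    have h2 : P.coeff 2 = P.coeff 4 := by
      simpa [Finset.sum_range_succ, sexticMoment, neg_add_eq_zero] using recurrence 1
    have h1 : P.coeff 1 = 0 := by
      simpa [Finset.sum_range_succ, sexticMoment, h3] using recurrence 2
    conv_lhs => rw [P.as_sum_range_C_mul_X_pow' (Nat.lt_succ_of_le hdeg)]
    simp [Finset.sum_range_succ, h1, h2, h3]
    ring
  have hlead : P.coeff 4 ≠ 0 := by
    intro h4
    rw [h4, map_zero, zero_mul, zero_add] at hPeq
    have h5 := hconst (Polynomial.natDegree_eq_zero.2 ⟨_, hPeq.symm⟩) 5 (by decide)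
    simp [sexticMoment] at h5
  rw [hPeq] at hsplits
  exact exists_sq_add_sq_of_splits hlead hsplits

theorem exists_sq_add_sq_generic [CharZero F] {s t : F} (h : s ^ 2 + t ^ 2 = -1) :
    ∃ s t : F, s ^ 2 + t ^ 2 = -1 ∧ s * t * (s ^ 2 - t ^ 2) ≠ 0 := by
  by_cases hst : s * t * (s ^ 2 - t ^ 2) = 0
  · -- With `z = s + t i` the product is `Im (z ^ 4) / 4`. Rotating `z` by `(3 + 4 i) / 5`, it can
    -- only stay zero if `Re (z ^ 4) = 0` as well, contradicting `|z| ^ 8 = 1`.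
    refine ⟨(3 * s - 4 * t) / 5, (4 * s + 3 * t) / 5, by linear_combination h, fun hst' => ?_⟩
    have hre : s ^ 4 - 6 * s ^ 2 * t ^ 2 + t ^ 4 = 0 := by
      linear_combination -(625 / 84) * hst' - (527 / 84) * hst
    have hnorm : (s ^ 4 - 6 * s ^ 2 * t ^ 2 + t ^ 4) ^ 2 + 16 * (s * t * (s ^ 2 - t ^ 2)) ^ 2 =
        (s ^ 2 + t ^ 2) ^ 4 := by ring
    rw [hre, hst, h] at hnorm
    norm_num at hnorm
  · exact ⟨s, t, h, hst⟩

theorem exists_sexticMoment_four [NeZero (2 : F)] {s t : F} (h : s ^ 2 + t ^ 2 = -1)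
    (hst : s * t * (s ^ 2 - t ^ 2) ≠ 0) :
    ∃ c a b : Fin 4 → F, ∀ k ≤ 6, powerMoment 6 c a b k = sexticMoment F k := by
  obtain ⟨⟨hs, ht⟩, hst⟩ : (s ≠ 0 ∧ t ≠ 0) ∧ s ^ 2 - t ^ 2 ≠ 0 := by
    simpa only [mul_ne_zero_iff] using hst
  obtain ⟨l, hl⟩ : ∃ l : F, 2 * l * (s ^ 2 - t ^ 2) = -1 :=
    ⟨-1 / (2 * (s ^ 2 - t ^ 2)), by field_simp⟩
  refine ⟨![l / s, -(l / s), -(l / t), l / t], ![s, -s, t, -t], 1, fun k hk => ?_⟩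
  have hodd (n : ℕ) : powerMoment 6 ![l / s, -(l / s), -(l / t), l / t] ![s, -s, t, -t] 1
      (2 * n + 1) = 2 * l * (s ^ (2 * n) - t ^ (2 * n)) := by
    simp [powerMoment, Fin.sum_univ_four, pow_succ]
    field_simp
    ring
  have heven (n : ℕ) : powerMoment 6 ![l / s, -(l / s), -(l / t), l / t] ![s, -s, t, -t] 1
      (2 * n) = 0 := by
    simp [powerMoment, Fin.sum_univ_four, (even_two_mul n).neg_pow]
  rcases Nat.even_or_odd' k with ⟨n, rfl | rfl⟩
  · rw [heven, sexticMoment, if_neg (by omega), if_neg (by omega)]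
  · rw [hodd]
    obtain rfl | rfl | rfl : n = 0 ∨ n = 1 ∨ n = 2 := by omega
    · simp [sexticMoment]
    · simpa [sexticMoment] using hl
    · have hl4 : 2 * l * (s ^ 4 - t ^ 4) = 1 := by linear_combination (s ^ 2 + t ^ 2) * hl - h
      simpa [sexticMoment] using hl4

theorem exists_sexticMoment_five [CharZero F] {w : F} (hw : w ^ 2 = -7) :
    ∃ c a b : Fin 5 → F, ∀ k ≤ 6, powerMoment 6 c a b k = sexticMoment F k := by
  -- The nodes are infinity and the roots of `X ^ 4 + X ^ 2 + 2 w X + 8`, which splits as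
  -- `(X ^ 2 - w X - 2) (X ^ 2 + w X - 4)`; their product is a quintic apolar to the form.
  refine ⟨![-2 * w, (w + 9) / 88, (w - 9) / 88, (5 - 3 * w) / 264, -(5 + 3 * w) / 264],
    ![1, (w + 1) / 2, (w - 1) / 2, (3 - w) / 2, -(3 + w) / 2], ![0, 1, 1, 1, 1], fun k hk => ?_⟩
  simp only [powerMoment, Fin.sum_univ_five, Matrix.cons_val]
  interval_cases k <;> simp [sexticMoment] <;> grind

theorem kLength_sextic_eq_four_iff (K : Subfield ℂ) :
    kLength K 6 (6 * X 0 ^ 5 * X 1 - 20 * X 0 ^ 3 * X 1 ^ 3) = 4 ↔ stufe K ≤ 2 := by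
  rw [← binaryForm_sexticMoment K, stufe_le_two_iff]
  refine (kLength_eq_succ_iff 3).trans ?_
  rw [hasPowerSumRep_binaryForm_iff, hasPowerSumRep_binaryForm_iff]
  refine ⟨fun ⟨⟨_, _, _, hμ⟩, _⟩ => exists_sq_add_sq_of_sexticMoment_four hμ, fun ⟨s, t, h⟩ => ?_⟩
  obtain ⟨s, t, h, hst⟩ := exists_sq_add_sq_generic h
  exact ⟨exists_sexticMoment_four h hst,
    fun ⟨c, a, b, hμ⟩ => powerMoment_ne_sexticMoment_three c a b hμ⟩

theorem kLength_sextic_eq_five {K : Subfield ℂ} {w : K} (hw : w ^ 2 = -7) (hK : ¬ stufe K ≤ 2) :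
    kLength K 6 (6 * X 0 ^ 5 * X 1 - 20 * X 0 ^ 3 * X 1 ^ 3) = 5 := by
  rw [stufe_le_two_iff] at hK
  rw [← binaryForm_sexticMoment K]
  refine (kLength_eq_succ_iff 4).2 ?_
  rw [hasPowerSumRep_binaryForm_iff, hasPowerSumRep_binaryForm_iff]
  exact ⟨exists_sexticMoment_five hw,
    fun ⟨_, _, _, hμ⟩ => hK (exists_sq_add_sq_of_sexticMoment_four hμ)⟩

end Sextic

section ThreeSquares

theorem exists_small_ne_zero_mem_ker {ι G : Type*} [Fintype ι] [AddGroup G] [Fintype G]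
    (φ : (ι → ℤ) →+ G) (B : ι → ℕ) (hB : Fintype.card G < ∏ i, (B i + 1)) :
    ∃ x ≠ 0, φ x = 0 ∧ ∀ i, |x i| ≤ B i := by
  classical
  obtain ⟨x, hx, y, hy, hxy, h⟩ := Finset.exists_ne_map_eq_of_card_lt_of_maps_to
    (s := Fintype.piFinset fun i => Finset.Icc (0 : ℤ) (B i)) (t := Finset.univ) (f := φ)
    (by simpa [Fintype.card_piFinset] using hB) fun _ _ => Finset.mem_coe.2 (Finset.mem_univ _)
  refine ⟨x - y, sub_ne_zero.2 hxy, by rw [map_sub, h, sub_self], fun i => ?_⟩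
  have hxi := Finset.mem_Icc.1 (Fintype.mem_piFinset.1 hx i)
  have hyi := Finset.mem_Icc.1 (Fintype.mem_piFinset.1 hy i)
  rw [Pi.sub_apply, abs_le]
  omega

theorem mul_lt_prod_sqrt_add_one (a b : ℕ) :
    a * b < ((a * b).sqrt + 1) * (a.sqrt + 1) * (b.sqrt + 1) := by
  have hsqrt : (a * b).sqrt < (a.sqrt + 1) * (b.sqrt + 1) := by
    rw [Nat.sqrt_lt', mul_pow]
    exact Nat.mul_lt_mul'' (Nat.lt_succ_sqrt' a) (Nat.lt_succ_sqrt' b)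
  calc a * b < ((a * b).sqrt + 1) * ((a * b).sqrt + 1) := Nat.lt_succ_sqrt _
    _ ≤ ((a * b).sqrt + 1) * ((a.sqrt + 1) * (b.sqrt + 1)) := Nat.mul_le_mul_left _ hsqrt
    _ = _ := (mul_assoc _ _ _).symm

theorem sq_le_of_abs_le_sqrt {x : ℤ} {n : ℕ} (h : |x| ≤ n.sqrt) : x ^ 2 ≤ n := by
  calc x ^ 2 ≤ (n.sqrt : ℤ) ^ 2 := sq_le_sq.2 (by rwa [Nat.abs_cast])
    _ ≤ n := mod_cast n.sqrt_le'

theorem sq_lt_of_abs_le_sqrt {x : ℤ} {n : ℕ} (hn : ¬ IsSquare n) (h : |x| ≤ n.sqrt) :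
    x ^ 2 < n := by
  refine (sq_le_of_abs_le_sqrt h).lt_of_ne fun hx => hn ⟨x.natAbs, ?_⟩
  rw [← Int.natCast_inj, Int.natCast_mul, Int.natAbs_mul_self', ← sq, hx]

theorem exists_small_dvd_ternary {a b : ℕ} (hab : a.Coprime b) (ha : 0 < a) (hb : ¬ IsSquare b)
    (hsb : IsSquare (-b : ZMod a)) (hsa : IsSquare (a : ZMod b)) :
    ∃ x y z : ℤ, (x ≠ 0 ∨ y ≠ 0 ∨ z ≠ 0) ∧ x ^ 2 < a * b ∧ y ^ 2 ≤ a ∧ z ^ 2 < b ∧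
      (a * b : ℤ) ∣ x ^ 2 + b * y ^ 2 - a * z ^ 2 := by
  obtain ⟨s, hs⟩ := hsb
  obtain ⟨r, hr⟩ := hsa
  have : NeZero a := ⟨ha.ne'⟩
  have : NeZero b := ⟨fun h => hb (h ▸ IsSquare.zero)⟩
  have hab' : ¬ IsSquare (a * b) := by
    rintro ⟨c, hc⟩
    obtain ⟨e, he⟩ := exists_eq_pow_of_mul_eq_pow (Nat.isUnit_iff.2 hab.symm)
      ((mul_comm b a).trans (hc.trans (sq c).symm))
    exact hb (he ▸ IsSquare.sq e)
  -- On `x ≡ s y` mod `a` and `x ≡ r z` mod `b` the form vanishes modulo both `a` and `b`.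
  let φ : (Fin 3 → ℤ) →+ ZMod a × ZMod b :=
    { toFun x := (x 0 - s * x 1, x 0 - r * x 2)
      map_zero' := by simp
      map_add' x y := by ext <;> simp <;> ring }
  obtain ⟨x, hx0, hφ, hx⟩ :=
    exists_small_ne_zero_mem_ker φ ![(a * b).sqrt, a.sqrt, b.sqrt]
      (by simpa [Fin.prod_univ_three] using mul_lt_prod_sqrt_add_one a b)
  have hxa : (x 0 : ZMod a) = s * x 1 := sub_eq_zero.1 (congrArg Prod.fst hφ)
  have hxb : (x 0 : ZMod b) = r * x 2 := sub_eq_zero.1 (congrArg Prod.snd hφ)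
  refine ⟨x 0, x 1, x 2, ?_, mod_cast sq_lt_of_abs_le_sqrt hab' (hx 0),
    sq_le_of_abs_le_sqrt (hx 1), sq_lt_of_abs_le_sqrt hb (hx 2), ?_⟩
  · contrapose! hx0
    ext i
    fin_cases i <;> simp [hx0]
  · refine (Nat.isCoprime_iff_coprime.2 hab).mul_dvd ?_ ?_
    · rw [← ZMod.intCast_zmod_eq_zero_iff_dvd]
      push_cast
      rw [hxa, ZMod.natCast_self]
      linear_combination -(x 1 : ZMod a) ^ 2 * hs
    · rw [← ZMod.intCast_zmod_eq_zero_iff_dvd]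
      push_cast
      rw [hxb, ZMod.natCast_self]
      linear_combination -(x 2 : ZMod b) ^ 2 * hr

theorem exists_sq_add_mul_sq_eq_mul_sq {a b : ℕ} (hab : a.Coprime b) (ha : 0 < a)
    (hb : ¬ IsSquare b) (hsb : IsSquare (-b : ZMod a)) (hsa : IsSquare (a : ZMod b)) :
    ∃ x y z : ℤ, z ≠ 0 ∧ x ^ 2 + b * y ^ 2 = a * z ^ 2 := by
  obtain ⟨x, y, z, hne, hx, hy, hz, k, hk⟩ := exists_small_dvd_ternary hab ha hb hsb hsa
  have ha' : (0 : ℤ) < a := mod_cast ha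
  have hb' : (0 : ℤ) < b := mod_cast Nat.pos_of_ne_zero fun h => hb (h ▸ IsSquare.zero)
  have hab0 : (0 : ℤ) < a * b := mul_pos ha' hb'
  have hk_lt : k < 2 := by
    refine lt_of_mul_lt_mul_left ?_ hab0.le
    nlinarith [mul_le_mul_of_nonneg_left hy hb'.le, mul_nonneg ha'.le (sq_nonneg z)]
  have hk_gt : -1 < k := by
    refine lt_of_mul_lt_mul_left ?_ hab0.le
    nlinarith [mul_lt_mul_of_pos_left hz ha', mul_nonneg hb'.le (sq_nonneg y), sq_nonneg x]
  obtain rfl | rfl : k = 0 ∨ k = 1 := by omega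
  · refine ⟨x, y, z, fun hz0 => ?_, by linear_combination hk⟩
    subst hz0
    have hx0 : x = 0 := by nlinarith [mul_nonneg hb'.le (sq_nonneg y)]
    have hy0 : y = 0 := by
      have : (b : ℤ) * y ^ 2 = 0 := by simpa [hx0] using hk
      simpa only [mul_eq_zero, hb'.ne', pow_eq_zero_iff two_ne_zero, false_or] using this
    simp [hx0, hy0] at hne
  · -- `x ^ 2 + b y ^ 2 = a (z ^ 2 + b)`: multiply by the norm `z ^ 2 + b` of `z + √-b`.
    exact ⟨x * z + b * y, y * z - x, z ^ 2 + b, by positivity,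
      by linear_combination (z ^ 2 + b) * hk⟩

theorem exists_three_rat_sq_of_dvd_sq_add_sq_add_one {m c d : ℕ} (hm : 0 < m)
    (hQ : ¬ IsSquare (c ^ 2 + d ^ 2)) (hdvd : m ∣ c ^ 2 + d ^ 2 + 1)
    (hsq : IsSquare (m : ZMod (c ^ 2 + d ^ 2))) :
    ∃ x y z : ℚ, x ^ 2 + y ^ 2 + z ^ 2 = m := by
  have hcop : m.Coprime (c ^ 2 + d ^ 2) :=
    Nat.Coprime.coprime_dvd_left hdvd (Nat.coprime_self_add_left.2 (Nat.coprime_one_left _))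
  have hneg : (-(c ^ 2 + d ^ 2 : ℕ) : ZMod m) = 1 := by
    rw [neg_eq_iff_add_eq_zero]
    exact_mod_cast (ZMod.natCast_eq_zero_iff _ _).2 hdvd
  obtain ⟨x, y, z, hz, h⟩ :=
    exists_sq_add_mul_sq_eq_mul_sq hcop hm hQ (hneg ▸ IsSquare.one) hsq
  have hzQ : (z : ℚ) ≠ 0 := Int.cast_ne_zero.2 hz
  have hQQ : (x : ℚ) ^ 2 + (c ^ 2 + d ^ 2) * y ^ 2 = m * z ^ 2 := mod_cast h
  refine ⟨x / z, c * y / z, d * y / z, ?_⟩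
  field_simp
  linear_combination hQQ

theorem exists_three_rat_sq_of_prime {m q : ℕ} (hm : 0 < m) (hq : q.Prime) (hq4 : q % 4 = 1)
    (hdvd : m ∣ q + 1) (hJ : jacobiSym m q = 1) :
    ∃ x y z : ℚ, x ^ 2 + y ^ 2 + z ^ 2 = m := by
  have : Fact q.Prime := ⟨hq⟩
  obtain ⟨c, d, rfl⟩ := Nat.Prime.sq_add_sq (p := q) (by omega)
  exact exists_three_rat_sq_of_dvd_sq_add_sq_add_one hm hq.prime.not_isSquare hdvd
    (mod_cast ZMod.isSquare_of_jacobiSym_eq_one hJ)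

theorem isSquare_zmod_mul {a b n : ℕ} (h : a.Coprime b) (ha : IsSquare (n : ZMod a))
    (hb : IsSquare (n : ZMod b)) : IsSquare (n : ZMod (a * b)) := by
  obtain ⟨x, hx⟩ := ha
  obtain ⟨y, hy⟩ := hb
  have hxy : IsSquare (n : ZMod a × ZMod b) := ⟨(x, y), Prod.ext hx hy⟩
  simpa only [map_natCast] using hxy.map (ZMod.chineseRemainder h).symm

theorem exists_three_rat_sq_of_two_mul_prime {m q : ℕ} (hm : 0 < m) (hq : q.Prime) (hq4 : q % 4 = 1)
    (hdvd : m ∣ 2 * q + 1) (hJ : jacobiSym m q = 1) :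
    ∃ x y z : ℚ, x ^ 2 + y ^ 2 + z ^ 2 = m := by
  have : Fact q.Prime := ⟨hq⟩
  obtain ⟨s, t, hst⟩ := Nat.Prime.sq_add_sq (p := q) (by omega)
  obtain ⟨c, d, hcd⟩ := Nat.sq_add_sq_mul (a := 2) (x := 1) (y := 1) rfl hst.symm
  have hnsq : ¬ IsSquare (2 * q) := by
    rintro ⟨k, hk⟩
    obtain ⟨j, rfl | rfl⟩ := Nat.even_or_odd' k <;> ring_nf at hk <;> omega
  have hsq : IsSquare (m : ZMod (2 * q)) :=
    isSquare_zmod_mul (Nat.coprime_two_left.2 (Nat.odd_iff.2 (by omega)))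
      ((by decide : ∀ x : ZMod 2, IsSquare x) m)
      (mod_cast ZMod.isSquare_of_jacobiSym_eq_one hJ)
  rw [hcd] at hdvd hnsq hsq
  exact exists_three_rat_sq_of_dvd_sq_add_sq_add_one hm hnsq hdvd hsq

theorem exists_prime_dvd_mul_add_one {M k e : ℕ} (hM : Odd M) (hk : k.Coprime M) (he : Odd e) :
    ∃ q, q.Prime ∧ M ∣ k * q + 1 ∧ q % 8 = e % 8 := by
  have coprime_eight {n : ℕ} (hn : Odd n) : n.Coprime 8 :=
    Nat.Coprime.pow_right 3 (Nat.coprime_two_right.2 hn)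
  obtain ⟨n, -, hn⟩ := Nat.exists_mul_mod_eq_of_coprime (M - 1) hk hM.pos.ne'
  have dvd_of_modEq {q : ℕ} (hq : q ≡ n [MOD M]) : M ∣ k * q + 1 := by
    have h : k * q + 1 ≡ M - 1 + 1 [MOD M] := ((hq.mul_left k).trans hn).add_right 1
    rw [Nat.sub_add_cancel hM.pos] at h
    exact (h.dvd_iff dvd_rfl).2 dvd_rfl
  obtain ⟨r, hrn, hre⟩ := Nat.chineseRemainder (coprime_eight hM) n e
  have hrM : r.Coprime M := by
    have h : (k * r).Coprime M := Nat.Coprime.coprime_dvd_right (dvd_of_modEq hrn)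
      (Nat.coprime_self_add_right.2 (Nat.coprime_one_right _))
    exact h.coprime_mul_left
  have hr8 : r.Coprime 8 := by
    rw [Nat.Coprime, hre.gcd_eq]
    exact coprime_eight he
  obtain ⟨q, -, hq, hqr⟩ := Nat.forall_exists_prime_gt_and_modEq 0
    (mul_ne_zero hM.pos.ne' (by decide : 8 ≠ 0)) (hrM.mul_right hr8)
  exact ⟨q, hq, dvd_of_modEq ((hqr.of_mul_right 8).trans hrn), (hqr.of_mul_left M).trans hre⟩

theorem jacobiSym_eq_of_dvd_add_one {M n : ℕ} (h : M ∣ n + 1) :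
    jacobiSym n M = jacobiSym (-1) M :=
  (jacobiSym.mod_left' (Int.modEq_iff_dvd.2 (by rw [sub_neg_eq_add]; exact_mod_cast h))).symm

theorem exists_three_rat_sq_of_mod_four_eq_one {m : ℕ} (hm : m % 4 = 1) :
    ∃ x y z : ℚ, x ^ 2 + y ^ 2 + z ^ 2 = m := by
  have hodd : Odd m := Nat.odd_iff.2 (by omega)
  obtain ⟨q, hq, hdvd, hq8⟩ :=
    exists_prime_dvd_mul_add_one hodd (Nat.coprime_one_left m) odd_one
  rw [one_mul] at hdvd
  have hq4 : q % 4 = 1 := by omega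
  refine exists_three_rat_sq_of_prime hodd.pos hq hq4 hdvd ?_
  calc jacobiSym m q = jacobiSym q m := jacobiSym.quadratic_reciprocity_one_mod_four' hodd hq4
    _ = jacobiSym (-1) m := jacobiSym_eq_of_dvd_add_one hdvd
    _ = 1 := by rw [jacobiSym.at_neg_one hodd, ZMod.χ₄_nat_one_mod_four hm]

theorem exists_three_rat_sq_of_mod_eight_eq_three {m : ℕ} (hm : m % 8 = 3) :
    ∃ x y z : ℚ, x ^ 2 + y ^ 2 + z ^ 2 = m := by
  have hodd : Odd m := Nat.odd_iff.2 (by omega)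
  obtain ⟨q, hq, hdvd, hq8⟩ :=
    exists_prime_dvd_mul_add_one hodd (Nat.coprime_two_left.2 hodd) odd_one
  have hq4 : q % 4 = 1 := by omega
  refine exists_three_rat_sq_of_two_mul_prime hodd.pos hq hq4 hdvd ?_
  have h2 : jacobiSym 2 m = -1 := by
    rw [jacobiSym.at_two hodd, ZMod.χ₈_nat_mod_eight, hm]
    rfl
  have hneg : jacobiSym (-1) m = -1 := by
    rw [jacobiSym.at_neg_one hodd, ZMod.χ₄_nat_three_mod_four (by omega)]
  have h2q : jacobiSym 2 m * jacobiSym q m = jacobiSym (-1) m := by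
    rw [← jacobiSym.mul_left]
    exact_mod_cast jacobiSym_eq_of_dvd_add_one hdvd
  rw [h2, hneg, neg_one_mul, neg_inj] at h2q
  rw [jacobiSym.quadratic_reciprocity_one_mod_four' hodd hq4, h2q]

theorem exists_three_rat_sq_of_two_mul_odd {M : ℕ} (hM : Odd M) :
    ∃ x y z : ℚ, x ^ 2 + y ^ 2 + z ^ 2 = (2 * M : ℕ) := by
  obtain ⟨e, he4, he⟩ : ∃ e : ℕ, e % 4 = 1 ∧ ZMod.χ₈ e = jacobiSym (-1) M := by
    rw [jacobiSym.at_neg_one hM]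
    rcases Nat.odd_mod_four_iff.1 (Nat.odd_iff.1 hM) with h | h
    · exact ⟨1, rfl, by rw [ZMod.χ₄_nat_one_mod_four h]; rfl⟩
    · exact ⟨5, rfl, by rw [ZMod.χ₄_nat_three_mod_four h]; rfl⟩
  obtain ⟨q, hq, hdvd, hq8⟩ := exists_prime_dvd_mul_add_one hM (Nat.coprime_one_left M)
    (Nat.odd_iff.2 (by omega) : Odd e)
  rw [one_mul] at hdvd
  have hq4 : q % 4 = 1 := by omega
  have hqodd : Odd q := Nat.odd_iff.2 (by omega)
  have hdvd2 : 2 * M ∣ q + 1 := (Nat.coprime_two_left.2 hM).mul_dvd_of_dvd_of_dvd (by omega) hdvd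
  refine exists_three_rat_sq_of_prime (by have := hM.pos; omega) hq hq4 hdvd2 ?_
  have h2 : jacobiSym 2 q = jacobiSym (-1) M := by
    rw [jacobiSym.at_two hqodd, ← he, ZMod.χ₈_nat_mod_eight, ZMod.χ₈_nat_mod_eight e, hq8]
  have hMq : jacobiSym M q = jacobiSym (-1) M := by
    rw [jacobiSym.quadratic_reciprocity_one_mod_four' hM hq4, jacobiSym_eq_of_dvd_add_one hdvd]
  rw [Nat.cast_mul, jacobiSym.mul_left, Nat.cast_two, h2, hMq, ← sq]
  exact jacobiSym.sq_one (by simp)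

theorem exists_three_rat_sq {m : ℕ} (h4 : ¬ 4 ∣ m) (h7 : m % 8 ≠ 7) :
    ∃ x y z : ℚ, x ^ 2 + y ^ 2 + z ^ 2 = m := by
  rcases Nat.even_or_odd' m with ⟨M, rfl | rfl⟩
  · exact exists_three_rat_sq_of_two_mul_odd (Nat.odd_iff.2 (by omega))
  · rcases (by omega : (2 * M + 1) % 4 = 1 ∨ (2 * M + 1) % 8 = 3) with h | h
    · exact exists_three_rat_sq_of_mod_four_eq_one h
    · exact exists_three_rat_sq_of_mod_eight_eq_three h

theorem sq_mod_eight (x : ℤ) : Even x ∧ 4 ∣ x ^ 2 ∨ x ^ 2 % 8 = 1 := by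
  rcases Int.even_or_odd x with ⟨y, rfl⟩ | hx
  · exact .inl ⟨⟨y, rfl⟩, y ^ 2, by ring⟩
  · have := Int.eight_dvd_sq_sub_one_of_odd hx
    omega

theorem even_of_eight_dvd_four_sq {x y z n : ℤ} (h : 8 ∣ x ^ 2 + y ^ 2 + z ^ 2 + n ^ 2) :
    Even x ∧ Even y ∧ Even z ∧ Even n := by
  have hx := sq_mod_eight x
  have hy := sq_mod_eight y
  have hz := sq_mod_eight z
  have hn := sq_mod_eight n
  grind

theorem eq_zero_of_three_sq_eq_mul_sq {m : ℕ} (hm : m % 8 = 7) {x y z n : ℤ}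
    (h : x ^ 2 + y ^ 2 + z ^ 2 = m * n ^ 2) : n = 0 := by
  induction hN : n.natAbs using Nat.strong_induction_on generalizing x y z n with
  | _ N ih =>
    have hdvd : 8 ∣ x ^ 2 + y ^ 2 + z ^ 2 + n ^ 2 := by
      rw [h, ← add_one_mul]
      exact dvd_mul_of_dvd_left (by omega) _
    obtain ⟨⟨x, rfl⟩, ⟨y, rfl⟩, ⟨z, rfl⟩, ⟨n, rfl⟩⟩ := even_of_eight_dvd_four_sq hdvd
    by_contra hn
    have hn0 := ih n.natAbs (by omega) (x := x) (y := y) (z := z) (by linarith) rfl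
    omega

theorem three_rat_sq_ne_of_mod_eight_eq_seven {m : ℕ} (hm : m % 8 = 7) (x y z : ℚ) :
    x ^ 2 + y ^ 2 + z ^ 2 ≠ m := by
  intro h
  have hden : ((x.den * y.den * z.den : ℕ) : ℤ) ≠ 0 :=
    mod_cast mul_ne_zero (mul_ne_zero x.den_ne_zero y.den_ne_zero) z.den_ne_zero
  refine hden (eq_zero_of_three_sq_eq_mul_sq hm (x := x.num * y.den * z.den)
    (y := y.num * x.den * z.den) (z := z.num * x.den * y.den) ?_)
  have hQ : (x * x.den * y.den * z.den) ^ 2 + (y * y.den * x.den * z.den) ^ 2 +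
      (z * z.den * x.den * y.den) ^ 2 = m * (x.den * y.den * z.den) ^ 2 := by
    rw [← h]
    ring
  simp only [Rat.mul_den_eq_num] at hQ
  exact_mod_cast hQ

end ThreeSquares

section ImaginaryQuadratic

theorem exists_sq_add_sq_of_four_sq_eq_zero {F : Type*} [Field F] {w x y z : F}
    (h : w ^ 2 + x ^ 2 + y ^ 2 + z ^ 2 = 0) (hw : w ≠ 0) : ∃ s t : F, s ^ 2 + t ^ 2 = -1 := by
  by_cases hwx : w ^ 2 + x ^ 2 = 0
  · exact ⟨x / w, 0, by field_simp; linear_combination hwx⟩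
  · -- `-1 = (y ^ 2 + z ^ 2) / (w ^ 2 + x ^ 2)`, and the sums of two squares are closed under
    -- division.
    refine ⟨(w * y + x * z) / (w ^ 2 + x ^ 2), (w * z - x * y) / (w ^ 2 + x ^ 2), ?_⟩
    field_simp
    linear_combination (w ^ 2 + x ^ 2) * h

theorem rat_eq_zero_of_add_mul_eq_zero {F : Type*} [Field F] [CharZero F] {m : ℕ} (hm : 0 < m)
    {w : F} (hw : w ^ 2 = -m) {p q : ℚ} (h : (p + q * w : F) = 0) : p = 0 ∧ q = 0 := by
  have hF : (p : F) ^ 2 + m * q ^ 2 = 0 := by linear_combination (p - q * w) * h + q ^ 2 * hw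
  have hQ : p ^ 2 + m * q ^ 2 = 0 := mod_cast hF
  have hmQ : (0 : ℚ) < m := Nat.cast_pos.2 hm
  have hq : q = 0 := by
    rw [← pow_eq_zero_iff two_ne_zero]
    nlinarith [sq_nonneg p, sq_nonneg q]
  simpa [hq] using hQ

theorem exists_sq_add_sq_iff_three_rat_sq {F : Type*} [Field F] [CharZero F] {m : ℕ} (hm : 0 < m)
    {w : F} (hw : w ^ 2 = -m) (hspan : ∀ u : F, ∃ a b : ℚ, u = a + b * w) :
    (∃ s t : F, s ^ 2 + t ^ 2 = -1) ↔ ∃ x y z : ℚ, x ^ 2 + y ^ 2 + z ^ 2 = m := by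
  refine ⟨fun ⟨s, t, h⟩ => ?_, fun ⟨x, y, z, h⟩ => ?_⟩
  · obtain ⟨a, b, rfl⟩ := hspan s
    obtain ⟨c, d, rfl⟩ := hspan t
    have hcoord : ((a ^ 2 + c ^ 2 - m * (b ^ 2 + d ^ 2) + 1 : ℚ) : F) +
        (2 * (a * b + c * d) : ℚ) * w = 0 := by
      push_cast
      linear_combination h - (b ^ 2 + d ^ 2) * hw
    obtain ⟨hre, him⟩ := rat_eq_zero_of_add_mul_eq_zero hm hw hcoord
    have hbd : b ^ 2 + d ^ 2 ≠ 0 := fun h0 => by nlinarith [sq_nonneg a, sq_nonneg c]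
    refine ⟨(b * c - a * d) / (b ^ 2 + d ^ 2), b / (b ^ 2 + d ^ 2), d / (b ^ 2 + d ^ 2), ?_⟩
    field_simp
    linear_combination (b ^ 2 + d ^ 2) * hre - (a * b + c * d) / 2 * him
  · have hF : (x : F) ^ 2 + y ^ 2 + z ^ 2 = m := mod_cast congrArg (Rat.cast (K := F)) h
    refine exists_sq_add_sq_of_four_sq_eq_zero (w := w) (x := x) (y := y) (z := z)
      (by linear_combination hw + hF) ?_
    rintro rfl
    exact hm.ne' (by simpa using hw)

theorem sq_sqrt_mul_I (m : ℕ) : (((Real.sqrt m : ℝ) : ℂ) * Complex.I) ^ 2 = -(m : ℂ) := by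
  rw [mul_pow, Complex.I_sq, mul_neg_one, ← Complex.ofReal_pow, Real.sq_sqrt (Nat.cast_nonneg m),
    Complex.ofReal_natCast]

theorem eq_add_mul_of_mem_adjoin {F : Type*} [Field F] [CharZero F] {m : ℕ}
    {w u : F} (hw : w ^ 2 = -m) (hu : u ∈ IntermediateField.adjoin ℚ {w}) :
    ∃ a b : ℚ, u = a + b * w := by
  have hint : IsIntegral ℚ w :=
    ⟨Polynomial.X ^ 2 + Polynomial.C (m : ℚ), Polynomial.monic_X_pow_add_C _ two_ne_zero,
      by simp [hw]⟩
  rw [← IntermediateField.mem_toSubalgebra,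
    IntermediateField.adjoin_simple_toSubalgebra_of_isAlgebraic hint.isAlgebraic] at hu
  induction hu using Algebra.adjoin_induction with
  | mem x hx => exact ⟨0, 1, by simpa using hx⟩
  | algebraMap r => exact ⟨r, 0, by simp⟩
  | add x y _ _ hx hy =>
    obtain ⟨⟨a, b, rfl⟩, c, d, rfl⟩ := hx, hy
    exact ⟨a + c, b + d, by push_cast; ring⟩
  | mul x y _ _ hx hy =>
    obtain ⟨⟨a, b, rfl⟩, c, d, rfl⟩ := hx, hy
    exact ⟨a * c - b * d * m, a * d + b * c, by push_cast; linear_combination b * d * hw⟩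

theorem exists_sqrt_neg_imagQuadraticField (m : ℕ) :
    ∃ w : imagQuadraticField m, w ^ 2 = -m ∧ ∀ u, ∃ a b : ℚ, u = a + b * w := by
  refine ⟨⟨_, IntermediateField.mem_adjoin_simple_self ℚ _⟩, Subtype.val_injective ?_,
    fun ⟨u, hu⟩ => ?_⟩
  · push_cast
    exact sq_sqrt_mul_I m
  · obtain ⟨a, b, rfl⟩ := eq_add_mul_of_mem_adjoin (sq_sqrt_mul_I m) hu
    exact ⟨a, b, Subtype.val_injective (by push_cast; rfl)⟩

theorem stufe_imagQuadraticField_le_two_iff {m : ℕ} (hm : 0 < m) :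
    stufe (imagQuadraticField m) ≤ 2 ↔ ∃ x y z : ℚ, x ^ 2 + y ^ 2 + z ^ 2 = m := by
  obtain ⟨w, hw, hspan⟩ := exists_sqrt_neg_imagQuadraticField m
  rw [stufe_le_two_iff, exists_sq_add_sq_iff_three_rat_sq hm hw hspan]

end ImaginaryQuadratic

theorem theorem4p2 (f : MvPolynomial (Fin 2) ℂ)
    (hf : f = 6 * X 0 ^ 5 * X 1 - 20 * X 0 ^ 3 * X 1 ^ 3) :
    (∀ K : Subfield ℂ, kLength K 6 f = 4 ↔ stufe K ≤ 2) ∧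
    (∀ m : ℕ, 0 < m → Squarefree m → ¬ m ≡ 7 [MOD 8] →
      kLength (imagQuadraticField m) 6 f = 4) ∧
    kLength (imagQuadraticField 7) 6 f = 5 := by
  subst hf
  refine ⟨kLength_sextic_eq_four_iff, fun m hm hsq h7 => ?_, ?_⟩
  · have h4 : ¬ 4 ∣ m := fun h => by simpa using hsq 2 h
    rw [kLength_sextic_eq_four_iff, stufe_imagQuadraticField_le_two_iff hm]
    exact exists_three_rat_sq h4 h7
  · obtain ⟨w, hw, -⟩ := exists_sqrt_neg_imagQuadraticField 7
    refine kLength_sextic_eq_five (mod_cast hw) fun h => ?_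
    obtain ⟨x, y, z, hxyz⟩ := (stufe_imagQuadraticField_le_two_iff (by decide)).1 h
    exact three_rat_sq_ne_of_mod_eight_eq_seven rfl x y z hxyz
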